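/- All spaces are real. For a Banach space $E$, $S_E$ is its unit sphere and $E^*$ its dual. Call $E$ uniformly smooth if for every $\varepsilon>0$ there is $\delta>0$ such that $\|x+y\|+\|x-y\|\le 2+\varepsilon\|y\|$ whenever $\|x\|=1$ and $\|y\|\le\delta$. A subset $A$ of a metric space $M$ is porous if there are $\lambda_0\in(0,1]$ and $r_0>0$ such that for all $x\in M$ and $r\in(0,r_0]$ there is $y\in M$ with $B(y;\lambda_0 r)\subseteq B(x;r)\cap(M\setminus A)$ (open balls); it is $\sigma$-porous if it is a countable union of porous sets. Let $X$ be a uniformly convex Banach space, $Y$ a uniformly smooth Banach space, $W\neq\{0\}$ a Banach space, and let $\theta:S_X\times S_{Y^*}\to\mathbb R$ be uniformly continuous with $\theta(-x,y^*)=\theta(x,-y^*)=-\theta(x,y^*)$ for all $(x,y^*)$, and such that $$\Pi_\theta=\Pi_\theta(X,Y):=\{(x,y^*)\in S_X\times S_{Y^*}:\theta(x,y^*)=1\}\neq\emptyset .$$ Let $C_{b,e}(\Pi_\theta,W)$ be the space of bounded continuous $\Phi:\Pi_\theta\to W$ with $\Phi(-x,-y^*)=\Phi(x,y^*)$, with the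 sup norm $\|\cdot\|_\infty$, and put $v_\theta(\Phi):=\sup_{(x,y^*)\in\Pi_\theta}\|\Phi(x,y^*)\|$. Say that $\Phi$ attains strongly (up to sign) its $\theta$-numerical radius if there is $(x_0,y_0^*)\in\Pi_\theta$ with $\|\Phi(x_0,y_0^*)\|=v_\theta(\Phi)$ and such that $$\min\big(\|x_n-x_0\|+\|y_n^*-y_0^*\|,\ \|x_n+x_0\|+\|y_n^*+y_0^*\|\big)\to0$$ for every sequence $(x_n,y_n^*)$ in $\Pi_\theta$ with $\|\Phi(x_n,y_n^*)\|\to v_\theta(\Phi)$. Let $(\mathcal Z,\|\cdot\|_{\mathcal Z})$ be a Banach space with a linear map $J:\mathcal Z\to C_{b,e}(\Pi_\theta,W)$ (for instance a linear subspace with its own complete norm and the inclusion map; $J$ need not be injective) such that (i) $\|J\Phi\|_\infty\le\|\Phi\|_{\mathcal Z}$ for all $\Phi\in\mathcal Z$; (ii) for every bounded finite rank operator $T:X\to Y$ and every $w\in W$ there is $\Phi\in\mathcal Z$ with $(J\Phi)(x,y^*)=y^*(Tx)\,w$ for all $(x,y^*)\in\Pi_\theta$ and $\|\Phi\|_{\mathcal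 Z}\le\|T\|\,\|w\|$. Then: (1) For every $\Theta\in C_{b,e}(\Pi_\theta,W)$, the set of all $\Phi\in\mathcal Z$ such that $\Theta+J\Phi$ attains strongly its $\theta$-numerical radius is the complement of a $\sigma$-porous subset of $(\mathcal Z,\|\cdot\|_{\mathcal Z})$. (2) For every $\varepsilon>0$ there is $\eta>0$ such that whenever $\Phi\in\mathcal Z$ and $(x,y^*)\in\Pi_\theta$ satisfy $v_\theta(J\Phi)=1$ and $\|(J\Phi)(x,y^*)\|>1-\eta$, there are $\Psi\in\mathcal Z$ and $(z,t^*)\in\Pi_\theta$ with $v_\theta(J\Psi)=1=\|(J\Psi)(z,t^*)\|$, $\|z-x\|+\|t^*-y^*\|<\varepsilon$ and $v_\theta(J\Psi-J\Phi)<\varepsilon$. (3) If $X$ is moreover uniformly smooth, then the set of bounded linear operators $T:X\to X$ that attain their numerical radius, i.e. for which there are $x_0\in S_X$, $x_0^*\in S_{X^*}$ with $x_0^*(x_0)=1$ and $|x_0^*(Tx_0)|=\sup\{|x^*(Tx)|:x\in S_X,\ x^*\in S_{X^*},\ x^*(x)=1\}$, is the complement of a $\sigma$-porous subset of the space of all bounded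 linear operators on $X$ with the operator norm. -/

import Mathlib

open Filter Topology
open scoped BoundedContinuousFunction

/-- A real normed space is uniformly smooth if for every `ε > 0` there is `δ > 0` such that
`‖x + y‖ + ‖x - y‖ ≤ 2 + ε ‖y‖` for all `x` with `‖x‖ = 1` and all `y` with `‖y‖ ≤ δ`; that is,
its modulus of smoothness `ρ` satisfies `ρ t / t → 0` as `t → 0`. -/
def IsUniformlySmooth (E : Type*) [NormedAddCommGroup E] [NormedSpace ℝ E] : Prop :=
  ∀ ε : ℝ, 0 < ε → ∃ δ : ℝ, 0 < δ ∧
    ∀ x y : E, ‖x‖ = 1 → ‖y‖ ≤ δ → ‖x + y‖ + ‖x - y‖ ≤ 2 + ε * ‖y‖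

/-- A subset `A` of a metric space is porous if there are `c ∈ (0, 1]` and `r₀ > 0` such that for
every point `x` and every `r ∈ (0, r₀]` some ball of radius `c * r` is contained in the ball of
centre `x` and radius `r` and misses `A`. -/
def IsPorousSet {M : Type*} [MetricSpace M] (A : Set M) : Prop :=
  ∃ c : ℝ, 0 < c ∧ c ≤ 1 ∧ ∃ r₀ : ℝ, 0 < r₀ ∧
    ∀ x : M, ∀ r : ℝ, 0 < r → r ≤ r₀ →
      ∃ y : M, Metric.ball y (c * r) ⊆ Metric.ball x r ∩ Aᶜ

/-- A set is σ-porous if it is a countable union of porous sets. -/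
def IsSigmaPorousSet {M : Type*} [MetricSpace M] (A : Set M) : Prop :=
  ∃ P : ℕ → Set M, (∀ n, IsPorousSet (P n)) ∧ A = ⋃ n, P n

/-- The product `S_X × S_{Y*}` of the unit spheres of `X` and of the dual of `Y`. -/
abbrev SphereProd (X Y : Type*) [NormedAddCommGroup X] [NormedSpace ℝ X]
    [NormedAddCommGroup Y] [NormedSpace ℝ Y] : Type _ :=
  Metric.sphere (0 : X) 1 × Metric.sphere (0 : StrongDual ℝ Y) 1

section ThetaRadius

variable {X Y : Type*} [NormedAddCommGroup X] [NormedSpace ℝ X]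
  [NormedAddCommGroup Y] [NormedSpace ℝ Y]

/-- The set `Π_θ(X, Y)` of all `(x, y*) ∈ S_X × S_{Y*}` with `θ (x, y*) = 1`. -/
def thetaPi (θ : SphereProd X Y → ℝ) : Set (SphereProd X Y) := {p | θ p = 1}

/-- The component in `X` of a point of `Π_θ(X, Y)`. -/
def thetaPiVec {θ : SphereProd X Y → ℝ} (p : thetaPi θ) : X := p.1.1

/-- The component in the dual of `Y` of a point of `Π_θ(X, Y)`. -/
def thetaPiFnl {θ : SphereProd X Y → ℝ} (p : thetaPi θ) : StrongDual ℝ Y := p.1.2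

/-- The space `C_{b,e}(Π_θ(X, Y), W)` of bounded continuous functions `Φ : Π_θ(X, Y) → W` with
`Φ (-x, -y*) = Φ (x, y*)`, a subspace of the bounded continuous functions with the sup norm. -/
def evenBCF (θ : SphereProd X Y → ℝ) (W : Type*) [NormedAddCommGroup W] [NormedSpace ℝ W] :
    Submodule ℝ (thetaPi θ →ᵇ W) where
  carrier := {Φ | ∀ p q : thetaPi θ,
    thetaPiVec q = -thetaPiVec p → thetaPiFnl q = -thetaPiFnl p → Φ q = Φ p}
  zero_mem' := fun _ _ _ _ => rfl
  add_mem' := by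
    intro Φ Ψ hΦ hΨ p q h₁ h₂
    simp [hΦ p q h₁ h₂, hΨ p q h₁ h₂]
  smul_mem' := by
    intro c Φ hΦ p q h₁ h₂
    simp [hΦ p q h₁ h₂]

variable {W : Type*} [NormedAddCommGroup W] [NormedSpace ℝ W]

/-- The `θ`-numerical radius `v_θ(Φ)`, the supremum of `‖Φ (x, y*)‖` over `Π_θ(X, Y)`. -/
noncomputable def thetaRadius {θ : SphereProd X Y → ℝ} (Φ : evenBCF θ W) : ℝ :=
  ⨆ p : thetaPi θ, ‖Φ.1 p‖

/-- `Φ` strongly (up to sign) attains its `θ`-numerical radius. -/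
def StronglyAttainsThetaRadius {θ : SphereProd X Y → ℝ} (Φ : evenBCF θ W) : Prop :=
  ∃ p₀ : thetaPi θ, ‖Φ.1 p₀‖ = thetaRadius Φ ∧
    ∀ p : ℕ → thetaPi θ,
      Tendsto (fun n => ‖Φ.1 (p n)‖) atTop (𝓝 (thetaRadius Φ)) →
      Tendsto (fun n =>
        min (‖thetaPiVec (p n) - thetaPiVec p₀‖ + ‖thetaPiFnl (p n) - thetaPiFnl p₀‖)
          (‖thetaPiVec (p n) + thetaPiVec p₀‖ + ‖thetaPiFnl (p n) + thetaPiFnl p₀‖)) atTop (𝓝 0)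

end ThetaRadius

/-- The numerical radius of a bounded operator `T` on `X`: the supremum of `|x* (T x)|` over all
`x ∈ S_X` and `x* ∈ S_{X*}` with `x* x = 1`. -/
noncomputable def numericalRadius {X : Type*} [NormedAddCommGroup X] [NormedSpace ℝ X]
    (T : X →L[ℝ] X) : ℝ :=
  sSup {s : ℝ | ∃ (x : X) (f : StrongDual ℝ X), ‖x‖ = 1 ∧ ‖f‖ = 1 ∧ f x = 1 ∧ s = |f (T x)|}

/-- `T` attains its numerical radius. -/
def AttainsNumericalRadius {X : Type*} [NormedAddCommGroup X] [NormedSpace ℝ X]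
    (T : X →L[ℝ] X) : Prop :=
  ∃ (x : X) (f : StrongDual ℝ X), ‖x‖ = 1 ∧ ‖f‖ = 1 ∧ f x = 1 ∧ |f (T x)| = numericalRadius T

/-!
On the complete metric space `Π_θ`, identify `p` with its antipode `-p`. Uniform convexity of `X`
and uniform smoothness of `Y` say that a rank one operator `T = g ⊗ y`, with `g` norming `x₀` and
`y` almost norming `y₀*`, makes `(x, y*) ↦ |y* (T x)|` peak at `±(x₀, y₀*)` with a gap depending
only on the scale; uniform continuity and oddness of `θ` exclude the pairs of mixed sign.

If `F p₀` is almost maximal, adding a small multiple of such a peak, pointing in the direction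
of `F p₀`, forces all almost maximal points into a small ball around `±p₀`, and this persists under
perturbations proportional to the size of the peak. Hence the functions whose slices fail to shrink
to scale `1 / (n + 1)` form a porous set, and outside the union of these sets completeness of
`Π_θ` yields a strong maximum. The same peak, followed by Baire's theorem, moves an almost maximal
point to a maximal one nearby.
-/

section Porosity

variable {M : Type*} [MetricSpace M] {A B : Set M}

theorem IsPorousSet.mono (hB : IsPorousSet B) (hAB : A ⊆ B) : IsPorousSet A := by
  obtain ⟨c, hc, hc1, r₀, hr₀, hball⟩ := hB
  refine ⟨c, hc, hc1, r₀, hr₀, fun x r hr hr' => ?_⟩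
  obtain ⟨y, hy⟩ := hball x r hr hr'
  exact ⟨y, hy.trans (Set.inter_subset_inter_right _ (Set.compl_subset_compl.2 hAB))⟩

theorem isSigmaPorousSet_of_subset_iUnion {P : ℕ → Set M} (hP : ∀ n, IsPorousSet (P n))
    (hA : A ⊆ ⋃ n, P n) : IsSigmaPorousSet A := by
  refine ⟨fun n => A ∩ P n, fun n => (hP n).mono Set.inter_subset_right, ?_⟩
  rw [← Set.inter_iUnion, Set.inter_eq_left.2 hA]

theorem IsSigmaPorousSet.mono (hB : IsSigmaPorousSet B) (hAB : A ⊆ B) : IsSigmaPorousSet A := by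
  obtain ⟨P, hP, rfl⟩ := hB
  exact isSigmaPorousSet_of_subset_iUnion hP hAB

theorem IsPorousSet.dense_interior_compl (hA : IsPorousSet A) : Dense (interior Aᶜ) := by
  obtain ⟨c, hc, _, r₀, hr₀, hball⟩ := hA
  refine Metric.dense_iff.2 fun x r hr => ?_
  have hr' : 0 < min r r₀ := lt_min hr hr₀
  obtain ⟨y, hy⟩ := hball x (min r r₀) hr' (min_le_right _ _)
  have hyc : y ∈ Metric.ball y (c * min r r₀) := Metric.mem_ball_self (mul_pos hc hr')
  exact ⟨y, Metric.ball_subset_ball (min_le_left _ _) (hy hyc).1,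
    mem_interior.2 ⟨_, fun z hz => (hy hz).2, Metric.isOpen_ball, hyc⟩⟩

theorem IsSigmaPorousSet.dense_compl [CompleteSpace M] (hA : IsSigmaPorousSet A) :
    Dense Aᶜ := by
  obtain ⟨P, hP, rfl⟩ := hA
  rw [Set.compl_iUnion]
  exact (dense_iInter_of_isOpen (fun n => isOpen_interior)
    fun n => (hP n).dense_interior_compl).mono (Set.iInter_mono fun n => interior_subset)

end Porosity

section UnitBallGeometry

variable {E : Type*} [NormedAddCommGroup E] [NormedSpace ℝ E]

theorem apply_le_norm_of_opNorm_le_one {f : StrongDual ℝ E} (hf : ‖f‖ ≤ 1) (x : E) : f x ≤ ‖x‖ := by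
  simpa using (le_abs_self _).trans (f.le_of_opNorm_le hf x)

theorem exists_norm_eq_one_lt_apply (f : StrongDual ℝ E) {r : ℝ} (hr : 0 ≤ r) (hrf : r < ‖f‖) :
    ∃ y : E, ‖y‖ = 1 ∧ r < f y := by
  by_contra! hle
  refine hrf.not_ge (f.opNorm_le_of_unit_norm hr fun z hz => abs_le'.2 ⟨hle z hz, ?_⟩)
  rw [← map_neg]
  exact hle (-z) (by rwa [norm_neg])

theorem exists_norm_eq_one_eq_norm_smul [Nontrivial E] (v : E) :
    ∃ w : E, ‖w‖ = 1 ∧ v = ‖v‖ • w := by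
  rcases eq_or_ne v 0 with rfl | hv
  · obtain ⟨w, hw⟩ := exists_norm_eq E zero_le_one
    exact ⟨w, hw, by simp⟩
  · have hv' : ‖v‖ ≠ 0 := norm_ne_zero_iff.2 hv
    refine ⟨‖v‖⁻¹ • v, ?_, (smul_inv_smul₀ hv' v).symm⟩
    rw [norm_smul, norm_inv, norm_norm, inv_mul_cancel₀ hv']

theorem norm_inv_norm_smul_sub_le {x : E} (hx : ‖x‖ = 1) (y : E) :
    ‖‖y‖⁻¹ • y - x‖ ≤ 2 * ‖y - x‖ := by
  rcases eq_or_ne y 0 with rfl | hy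
  · simp [hx]
  have hscale : ‖‖y‖⁻¹ • y - y‖ = |‖x‖ - ‖y‖| := by
    have hy' : ‖y‖ ≠ 0 := norm_ne_zero_iff.2 hy
    have hdiff : ‖y‖⁻¹ • y - y = (‖x‖ - ‖y‖) • ‖y‖⁻¹ • y := by
      rw [sub_smul, hx, one_smul, smul_inv_smul₀ hy']
    rw [hdiff, norm_smul, norm_smul, norm_inv, norm_norm, inv_mul_cancel₀ hy', mul_one,
      Real.norm_eq_abs]
  calc ‖‖y‖⁻¹ • y - x‖ ≤ ‖‖y‖⁻¹ • y - y‖ + ‖y - x‖ := norm_sub_le_norm_sub_add_norm_sub _ _ _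
    _ ≤ ‖y - x‖ + ‖y - x‖ := by
      rw [hscale, norm_sub_rev y x]
      gcongr
      exact abs_norm_sub_norm_le x y
    _ = 2 * ‖y - x‖ := (two_mul _).symm

variable (E) in
theorem exists_forall_slice_norm_sub_lt [UniformConvexSpace E] {ε : ℝ} (hε : 0 < ε) :
    ∃ δ > 0, ∀ f : StrongDual ℝ E, ‖f‖ ≤ 1 → ∀ x y : E, ‖x‖ ≤ 1 → ‖y‖ ≤ 1 →
      1 - δ < f x → 1 - δ < f y → ‖x - y‖ < ε := by
  obtain ⟨δ, hδ, hconv⟩ := exists_forall_closed_ball_dist_add_le_two_sub E hε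
  refine ⟨δ / 2, half_pos hδ, fun f hf x y hx hy hfx hfy => ?_⟩
  by_contra! hxy
  have hsum : f x + f y ≤ ‖x + y‖ := by
    rw [← map_add]
    exact apply_le_norm_of_opNorm_le_one hf _
  linarith [hconv hx hy hxy]

theorem IsUniformlySmooth.exists_forall_dual_slice_norm_sub_lt (hE : IsUniformlySmooth E)
    {ε : ℝ} (hε : 0 < ε) :
    ∃ δ > 0, ∀ y : E, ‖y‖ = 1 → ∀ f g : StrongDual ℝ E, ‖f‖ ≤ 1 → ‖g‖ ≤ 1 →
      1 - δ < f y → 1 - δ < g y → ‖f - g‖ < ε := by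
  obtain ⟨t, ht, hsmooth⟩ := hE (ε / 4) (by positivity)
  refine ⟨ε / 8 * t, by positivity, fun y hy f g hf hg hfy hgy => ?_⟩
  have hle : ∀ z : E, ‖z‖ = 1 → (f - g) z ≤ ε / 2 := by
    intro z hz
    have htz : ‖t • z‖ = t := by rw [norm_smul, hz, mul_one, Real.norm_of_nonneg ht.le]
    have hnorm : ‖y + t • z‖ + ‖y - t • z‖ ≤ 2 + ε / 4 * t := by
      simpa only [htz] using hsmooth y (t • z) hy htz.le
    have hf' : f y + t * f z ≤ ‖y + t • z‖ := by
      simpa using apply_le_norm_of_opNorm_le_one hf (y + t • z)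
    have hg' : g y - t * g z ≤ ‖y - t • z‖ := by
      simpa using apply_le_norm_of_opNorm_le_one hg (y - t • z)
    have hscaled : t * (f - g) z ≤ t * (ε / 2) := by
      rw [sub_apply]
      linarith
    exact le_of_mul_le_mul_left hscaled ht
  refine lt_of_le_of_lt ((f - g).opNorm_le_of_unit_norm (half_pos hε).le fun z hz => ?_)
    (half_lt_self hε)
  refine abs_le'.2 ⟨hle z hz, ?_⟩
  rw [← map_neg]
  exact hle (-z) (by rwa [norm_neg])

variable (E) in
theorem exists_forall_slice_min_norm_lt [UniformConvexSpace E] {ε : ℝ} (hε : 0 < ε) :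
    ∃ δ > 0, ∀ f : StrongDual ℝ E, ‖f‖ ≤ 1 → ∀ x x₀ : E, ‖x‖ ≤ 1 → ‖x₀‖ ≤ 1 →
      1 - δ < |f x| → 1 - δ < f x₀ → min ‖x - x₀‖ ‖x + x₀‖ < ε := by
  obtain ⟨δ, hδ, hslice⟩ := exists_forall_slice_norm_sub_lt E hε
  refine ⟨δ, hδ, fun f hf x x₀ hx hx₀ hfx hfx₀ => ?_⟩
  rcases lt_abs.1 hfx with hpos | hneg
  · exact min_lt_of_left_lt (hslice f hf x x₀ hx hx₀ hpos hfx₀)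
  · have h := hslice f hf (-x) x₀ (by rwa [norm_neg]) hx₀ (by rwa [map_neg]) hfx₀
    rw [← neg_add', norm_neg] at h
    exact min_lt_of_right_lt h

theorem IsUniformlySmooth.exists_forall_dual_slice_min_norm_lt (hE : IsUniformlySmooth E)
    {ε : ℝ} (hε : 0 < ε) :
    ∃ δ > 0, ∀ y : E, ‖y‖ = 1 → ∀ f f₀ : StrongDual ℝ E, ‖f‖ ≤ 1 → ‖f₀‖ ≤ 1 →
      1 - δ < |f y| → 1 - δ < f₀ y → min ‖f - f₀‖ ‖f + f₀‖ < ε := by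
  obtain ⟨δ, hδ, hslice⟩ := hE.exists_forall_dual_slice_norm_sub_lt hε
  refine ⟨δ, hδ, fun y hy f f₀ hf hf₀ hfy hfy₀ => ?_⟩
  rcases lt_abs.1 hfy with hpos | hneg
  · exact min_lt_of_left_lt (hslice y hy f f₀ hf hf₀ hpos hfy₀)
  · have h := hslice y hy (-f) f₀ (by rwa [norm_neg]) hf₀ (by rwa [neg_apply]) hfy₀
    rw [← neg_add', norm_neg] at h
    exact min_lt_of_right_lt h

end UnitBallGeometry

section SignDist

/-- The distance of `p` from the pair `{q, σ q}`. For an isometric involution `σ` it is the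
distance between orbits; with `σ` the antipodal map it is the distance up to sign. -/
def signDist {M : Type*} [Dist M] (σ : M → M) (p q : M) : ℝ := min (dist p q) (dist p (σ q))

variable {M : Type*} [PseudoMetricSpace M] {σ : M → M}

theorem signDist_nonneg (σ : M → M) (p q : M) : 0 ≤ signDist σ p q :=
  le_min dist_nonneg dist_nonneg

theorem dist_apply_right_eq (hσ : Isometry σ) (hσσ : Function.Involutive σ) (p q : M) :
    dist p (σ q) = dist (σ p) q := by
  rw [← hσ.dist_eq, hσσ q]

theorem signDist_le_add_signDist (hσ : Isometry σ) (hσσ : Function.Involutive σ) (p q r : M) :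
    signDist σ p q ≤ signDist σ p r + signDist σ q r := by
  have hσqr : dist (σ q) r = dist q (σ r) := (dist_apply_right_eq hσ hσσ q r).symm
  have hσσqr : dist (σ q) (σ r) = dist q r := hσ.dist_eq q r
  have := dist_triangle_right p q r
  have := dist_triangle_right p q (σ r)
  have := dist_triangle_right p (σ q) r
  have := dist_triangle_right p (σ q) (σ r)
  unfold signDist
  grind

theorem exists_apply_eq_and_dist_eq_signDist {α : Type*} (hσ : Isometry σ)
    (hσσ : Function.Involutive σ) {f : M → α} (hf : ∀ p, f (σ p) = f p) (p q : M) :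
    ∃ p', f p' = f p ∧ dist p' q = signDist σ p q := by
  rcases min_choice (dist p q) (dist p (σ q)) with h | h
  · exact ⟨p, rfl, h.symm⟩
  · exact ⟨σ p, hf p, ((dist_apply_right_eq hσ hσσ p q).symm.trans h.symm)⟩

end SignDist

section StrongMaximum

/-- Some slice `{p | v - γ < f p}` lies in the `d`-ball of radius `ε` about one of the points.
It is used with `v` the supremum of `f` and `d` a distance up to sign. -/
def SlicesLocalize {M : Type*} (d : M → M → ℝ) (f : M → ℝ) (v ε : ℝ) : Prop :=
  ∃ p₀, ∃ γ > 0, ∀ p, v - γ < f p → d p p₀ < ε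

variable {M : Type*} [PseudoMetricSpace M] {σ : M → M} {f : M → ℝ} {v : ℝ}

theorem SlicesLocalize.exists_forall_signDist_lt {ε : ℝ} (hσ : Isometry σ)
    (hσσ : Function.Involutive σ) (hloc : SlicesLocalize (signDist σ) f v (ε / 2)) :
    ∃ γ > 0, ∀ p q, v - γ < f p → v - γ < f q → signDist σ p q < ε := by
  obtain ⟨p₀, γ, hγ, hball⟩ := hloc
  refine ⟨γ, hγ, fun p q hp hq => ?_⟩
  linarith [signDist_le_add_signDist hσ hσσ p q p₀, hball p hp, hball q hq]

theorem exists_near_of_slice {ε γ γ' : ℝ} (hσ : Isometry σ) (hσσ : Function.Involutive σ)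
    (hfσ : ∀ p, f (σ p) = f p) (hv : IsLUB (Set.range f) v) (hγ : 0 < γ) (hγ' : 0 < γ')
    (hslice : ∀ p q, v - γ < f p → v - γ < f q → signDist σ p q < ε) {q : M}
    (hq : v - γ < f q) : ∃ q', v - γ' < f q' ∧ dist q q' < ε := by
  obtain ⟨_, ⟨p, rfl⟩, hp, -⟩ := hv.exists_between_sub_self (lt_min hγ hγ')
  obtain ⟨q', hfq', hdist⟩ := exists_apply_eq_and_dist_eq_signDist hσ hσσ hfσ p q
  refine ⟨q', ?_, ?_⟩
  · rw [hfq']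
    linarith [min_le_right γ γ']
  · rw [dist_comm, hdist]
    exact hslice p q (by linarith [min_le_left γ γ']) hq

theorem exists_cauchySeq_tendsto_apply (hσ : Isometry σ) (hσσ : Function.Involutive σ)
    (hfσ : ∀ p, f (σ p) = f p) (hv : IsLUB (Set.range f) v)
    (hloc : ∀ ε > 0, ∃ γ > 0, ∀ p q, v - γ < f p → v - γ < f q → signDist σ p q < ε) :
    ∃ u : ℕ → M, CauchySeq u ∧ Tendsto (fun n => f (u n)) atTop (𝓝 v) := by
  choose γ hγ hslice using fun n : ℕ => hloc ((1 / 2) ^ n) (by positivity)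
  let ρ : ℕ → ℝ := fun n => min (γ n) ((1 / 2) ^ n)
  have hρ : ∀ n, 0 < ρ n := fun n => lt_min (hγ n) (by positivity)
  have hstep : ∀ n (q : {q // v - ρ n < f q}),
      ∃ q' : {q' // v - ρ (n + 1) < f q'}, dist q.1 q'.1 < (1 / 2) ^ n := by
    rintro n ⟨q, hq⟩
    have hq' : v - γ n < f q := (sub_le_sub_left (min_le_left _ _) v).trans_lt hq
    obtain ⟨q', hfq', hdist⟩ :=
      exists_near_of_slice hσ hσσ hfσ hv (hγ n) (hρ (n + 1)) (hslice n) hq'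
    exact ⟨⟨q', hfq'⟩, hdist⟩
  choose next hnext using hstep
  obtain ⟨_, ⟨q₀, rfl⟩, hq₀, -⟩ := hv.exists_between_sub_self (hρ 0)
  let u : ∀ n, {q // v - ρ n < f q} := fun n => Nat.rec ⟨q₀, hq₀⟩ next n
  refine ⟨fun n => (u n).1, cauchySeq_of_le_geometric (1 / 2) 1 (by norm_num) fun n => ?_, ?_⟩
  · rw [one_mul]
    exact (hnext n (u n)).le
  · have hlower : Tendsto (fun n : ℕ => v - (1 / 2 : ℝ) ^ n) atTop (𝓝 v) := by
      simpa using tendsto_const_nhds.sub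
        (tendsto_pow_atTop_nhds_zero_of_lt_one (r := (1 / 2 : ℝ)) (by norm_num) (by norm_num))
    exact tendsto_of_tendsto_of_tendsto_of_le_of_le hlower tendsto_const_nhds
      (fun n => (sub_le_sub_left (min_le_right _ _) v).trans (u n).2.le)
      fun n => hv.1 ⟨_, rfl⟩

theorem exists_strong_maximizer_of_slicesLocalize [CompleteSpace M] (hσ : Isometry σ)
    (hσσ : Function.Involutive σ) (hf : Continuous f) (hfσ : ∀ p, f (σ p) = f p)
    (hv : IsLUB (Set.range f) v) (hloc : ∀ ε > 0, SlicesLocalize (signDist σ) f v ε) :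
    ∃ p₀, f p₀ = v ∧ ∀ u : ℕ → M, Tendsto (fun n => f (u n)) atTop (𝓝 v) →
      Tendsto (fun n => signDist σ (u n) p₀) atTop (𝓝 0) := by
  have hslice : ∀ ε > 0, ∃ γ > 0, ∀ p q, v - γ < f p → v - γ < f q → signDist σ p q < ε :=
    fun ε hε => (hloc _ (half_pos hε)).exists_forall_signDist_lt hσ hσσ
  obtain ⟨u, hu, hfu⟩ := exists_cauchySeq_tendsto_apply hσ hσσ hfσ hv hslice
  obtain ⟨p₀, hp₀⟩ := cauchySeq_tendsto_of_complete hu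
  have hfp₀ : f p₀ = v := tendsto_nhds_unique ((hf.tendsto p₀).comp hp₀) hfu
  refine ⟨p₀, hfp₀, fun s hs => Metric.tendsto_nhds.2 fun ε hε => ?_⟩
  obtain ⟨γ, hγ, hball⟩ := hslice ε hε
  filter_upwards [hs.eventually_const_lt (sub_lt_self v hγ)] with n hn
  rw [Real.dist_0_eq_abs, abs_of_nonneg (signDist_nonneg _ _ _)]
  exact hball _ _ hn (by rw [hfp₀]; exact sub_lt_self v hγ)

end StrongMaximum

section BoundedContinuousNorm

variable {M W : Type*} [TopologicalSpace M] [NormedAddCommGroup W]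

theorem norm_apply_le_norm_apply_add (F G : M →ᵇ W) (p : M) : ‖F p‖ ≤ ‖G p‖ + ‖F - G‖ :=
  (norm_le_insert' (F p) (G p)).trans (add_le_add_right ((F - G).norm_coe_le_norm p) _)

theorem isLUB_range_norm_apply [Nonempty M] (F : M →ᵇ W) :
    IsLUB (Set.range fun p => ‖F p‖) ‖F‖ := by
  rw [F.norm_eq_iSup_norm]
  exact isLUB_ciSup F.bddAbove_range_norm_comp

theorem dist_lt_of_near_peak {d : M → M → ℝ} {F P G : M →ᵇ W} {p₀ q : M} {ε τ : ℝ}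
    (hpeak : ∀ p, ε ≤ d p p₀ → ‖P p‖ - ‖F‖ + τ ≤ ‖P p₀‖ - ‖F p₀‖)
    (hp₀ : ‖F‖ - τ / 4 < ‖F p₀‖) (hG : ‖G - P‖ ≤ τ / 4) (hq : ‖G‖ - τ / 4 < ‖G q‖) :
    d q p₀ < ε := by
  by_contra! hfar
  have hGq := norm_apply_le_norm_apply_add G P q
  have hPp₀ := norm_apply_le_norm_apply_add P G p₀
  rw [norm_sub_rev] at hPp₀
  linarith [hpeak q hfar, G.norm_coe_le_norm p₀]

end BoundedContinuousNorm

section PeakPerturbations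

variable {M W Z : Type*} [TopologicalSpace M] [NormedAddCommGroup W] [NormedSpace ℝ W]
  [NormedAddCommGroup Z] [NormedSpace ℝ Z]

/-- At every scale `ε` there is a gap `κ` such that any `F` can be made to peak near any point `p₀`
by adding multiples `s • J H` of the image of one element `H` of the unit ball: outside the
`d`-ball of radius `ε` about `p₀`, the excess over `‖F‖` is less by `s * κ` than the increase
of the norm at `p₀`. -/
def HasPeakPerturbations (J : Z →ₗ[ℝ] (M →ᵇ W)) (d : M → M → ℝ) : Prop :=
  ∀ ε > 0, ∃ κ ∈ Set.Ioc (0 : ℝ) 1, ∀ (F : M →ᵇ W) (p₀ : M), ∃ H : Z, ‖H‖ ≤ 1 ∧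
    ∀ s ≥ 0, ∀ p, ε ≤ d p p₀ →
      ‖(F + s • J H) p‖ - ‖F‖ + s * κ ≤ ‖(F + s • J H) p₀‖ - ‖F p₀‖

variable {J : Z →ₗ[ℝ] (M →ᵇ W)} {d : M → M → ℝ}

theorem hasPeakPerturbations_of_scalar_peaks [Nontrivial W]
    (hJ : ∀ ε > 0, ∃ κ ∈ Set.Ioc (0 : ℝ) 1, ∀ p₀ : M, ∃ k : M → ℝ,
      (∀ p, ε ≤ d p p₀ → |k p| + κ ≤ k p₀) ∧
      ∀ w : W, ∃ H : Z, (∀ p, J H p = k p • w) ∧ ‖H‖ ≤ ‖w‖) :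
    HasPeakPerturbations J d := by
  intro ε hε
  obtain ⟨κ, hκ, hpeak⟩ := hJ ε hε
  refine ⟨κ, hκ, fun F p₀ => ?_⟩
  obtain ⟨k, hk, hkZ⟩ := hpeak p₀
  obtain ⟨w, hw, hFw⟩ := exists_norm_eq_one_eq_norm_smul (F p₀)
  obtain ⟨H, hH, hHw⟩ := hkZ w
  refine ⟨H, hHw.trans_eq hw, fun s hs p hp => ?_⟩
  have happly : ∀ p, (F + s • J H) p = F p + (s * k p) • w := fun p => by
    rw [mul_smul, ← hH p]
    rfl
  have hfar : ‖(F + s • J H) p‖ ≤ ‖F‖ + s * |k p| := by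
    rw [happly]
    refine norm_add_le_of_le (F.norm_coe_le_norm p) (le_of_eq ?_)
    rw [norm_smul, hw, mul_one, Real.norm_eq_abs, abs_mul, abs_of_nonneg hs]
  -- `w` points in the direction of `F p₀`, so that no norm is lost there
  have hat : ‖F p₀‖ + s * k p₀ ≤ ‖(F + s • J H) p₀‖ := by
    rw [happly, hFw, ← add_smul, norm_smul, norm_smul, hw, mul_one, mul_one, norm_norm]
    exact le_abs_self _
  linarith [mul_le_mul_of_nonneg_left (hk p hp) hs]

theorem norm_sub_lt_add_of_mem_ball {Φ Ψ H : Z} {r s : ℝ} (hs : 0 ≤ s) (hH : ‖H‖ ≤ 1)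
    (hΨ : Ψ ∈ Metric.ball (Φ + s • H) r) : ‖Ψ - Φ‖ < r + s := by
  rw [mem_ball_iff_norm] at hΨ
  have hsH : ‖s • H‖ ≤ s := by
    rw [norm_smul, Real.norm_of_nonneg hs]
    exact mul_le_of_le_one_right hs hH
  calc ‖Ψ - Φ‖ = ‖Ψ - (Φ + s • H) + s • H‖ := by congr 1; abel
    _ < r + s := (norm_add_le _ _).trans_lt (add_lt_add_of_lt_of_le hΨ hsH)

theorem HasPeakPerturbations.isPorousSet_not_slicesLocalize [Nonempty M]
    (hpeak : HasPeakPerturbations J d) (hJ : ∀ Φ, ‖J Φ‖ ≤ ‖Φ‖) {ε : ℝ} (hε : 0 < ε)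
    (Θ : M →ᵇ W) :
    IsPorousSet {Φ : Z | ¬ SlicesLocalize d (fun p => ‖(Θ + J Φ) p‖) ‖Θ + J Φ‖ ε} := by
  obtain ⟨κ, ⟨hκ, hκ1⟩, hpeak⟩ := hpeak ε hε
  refine ⟨κ / 8, by positivity, by linarith, 1, one_pos, fun Φ r hr _ => ?_⟩
  have hτ : 0 < r / 2 * κ / 4 := by positivity
  obtain ⟨_, ⟨p₀, rfl⟩, hp₀, -⟩ :=
    (isLUB_range_norm_apply (Θ + J Φ)).exists_between_sub_self hτ
  obtain ⟨H, hH, hHpeak⟩ := hpeak (Θ + J Φ) p₀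
  refine ⟨Φ + (r / 2) • H, fun Ψ hΨ => ⟨?_, not_not.2 ⟨p₀, _, hτ, fun p hp => ?_⟩⟩⟩
  · rw [mem_ball_iff_norm]
    refine (norm_sub_lt_add_of_mem_ball (half_pos hr).le hH hΨ).trans_le ?_
    nlinarith
  · have hclose : ‖Θ + J Ψ - (Θ + J Φ + (r / 2) • J H)‖ ≤ r / 2 * κ / 4 := by
      rw [mem_ball_iff_norm] at hΨ
      calc ‖Θ + J Ψ - (Θ + J Φ + (r / 2) • J H)‖ = ‖J (Ψ - (Φ + (r / 2) • H))‖ := by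
            rw [map_sub, map_add, map_smul, add_assoc, add_sub_add_left_eq_sub]
        _ ≤ κ / 8 * r := (hJ _).trans hΨ.le
        _ = r / 2 * κ / 4 := by ring
    exact dist_lt_of_near_peak (hHpeak _ (half_pos hr).le) hp₀ hclose hp

theorem HasPeakPerturbations.exists_normAttaining_near (hpeak : HasPeakPerturbations J d)
    (hJ : ∀ Φ, ‖J Φ‖ ≤ ‖Φ‖) (hdense : Dense {Φ : Z | ∃ q, ‖J Φ q‖ = ‖J Φ‖})
    {ε r : ℝ} (hε : 0 < ε) (hr : 0 < r) :
    ∃ η > 0, ∀ (Φ : Z) (p : M), ‖J Φ‖ - η < ‖J Φ p‖ →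
      ∃ (Ψ : Z) (q : M), ‖J Ψ q‖ = ‖J Ψ‖ ∧ d q p < ε ∧ ‖Ψ - Φ‖ < r := by
  obtain ⟨κ, ⟨hκ, hκ1⟩, hpeak⟩ := hpeak ε hε
  have hτ : 0 < r / 2 * κ / 4 := by positivity
  refine ⟨r / 2 * κ / 4, hτ, fun Φ p hp => ?_⟩
  obtain ⟨H, hH, hHpeak⟩ := hpeak (J Φ) p
  obtain ⟨Ψ, hΨ, q, hq⟩ := Metric.dense_iff.1 hdense (Φ + (r / 2) • H) _ hτ
  have hclose : ‖J Ψ - (J Φ + (r / 2) • J H)‖ ≤ r / 2 * κ / 4 := by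
    rw [← map_smul, ← map_add, ← map_sub]
    exact (hJ _).trans (mem_ball_iff_norm.1 hΨ).le
  refine ⟨Ψ, q, hq, dist_lt_of_near_peak (hHpeak _ (half_pos hr).le) hp hclose ?_, ?_⟩
  · rw [hq]
    exact sub_lt_self _ hτ
  · refine (norm_sub_lt_add_of_mem_ball (half_pos hr).le hH hΨ).trans_le ?_
    nlinarith

theorem HasPeakPerturbations.exists_unit_normAttaining_near (hpeak : HasPeakPerturbations J d)
    (hJ : ∀ Φ, ‖J Φ‖ ≤ ‖Φ‖) (hdense : Dense {Φ : Z | ∃ q, ‖J Φ q‖ = ‖J Φ‖})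
    {ε : ℝ} (hε : 0 < ε) :
    ∃ η > 0, ∀ (Φ : Z) (p : M), ‖J Φ‖ = 1 → 1 - η < ‖J Φ p‖ →
      ∃ (Ψ : Z) (q : M), ‖J Ψ‖ = 1 ∧ ‖J Ψ q‖ = 1 ∧ d q p < ε ∧ ‖J Ψ - J Φ‖ < ε := by
  obtain ⟨η, hη, hnear⟩ := hpeak.exists_normAttaining_near hJ hdense hε
    (lt_min (half_pos hε) one_pos)
  refine ⟨η, hη, fun Φ p hΦ hp => ?_⟩
  obtain ⟨Ψ, q, hq, hqp, hΨΦ⟩ := hnear Φ p (by rwa [hΦ])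
  have hdist : ‖J Ψ - J Φ‖ < min (ε / 2) 1 := by
    rw [← map_sub]
    exact (hJ _).trans_lt hΨΦ
  have hΨ0 : ‖J Ψ‖ ≠ 0 := by
    rw [norm_ne_zero_iff]
    intro h0
    rw [h0, zero_sub, norm_neg, hΦ] at hdist
    exact (hdist.trans_le (min_le_right _ _)).false
  refine ⟨‖J Ψ‖⁻¹ • Ψ, q, ?_, ?_, hqp, ?_⟩ <;> rw [map_smul]
  · rw [norm_smul, norm_inv, norm_norm, inv_mul_cancel₀ hΨ0]
  · rw [BoundedContinuousFunction.smul_apply, norm_smul, norm_inv, norm_norm, hq,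
      inv_mul_cancel₀ hΨ0]
  · linarith [norm_inv_norm_smul_sub_le hΦ (J Ψ), hdist.trans_le (min_le_left _ _)]

end PeakPerturbations

section ThetaPi

variable {X Y : Type*} [NormedAddCommGroup X] [NormedSpace ℝ X]
  [NormedAddCommGroup Y] [NormedSpace ℝ Y] {θ : SphereProd X Y → ℝ}

theorem norm_thetaPiVec (p : thetaPi θ) : ‖thetaPiVec p‖ = 1 := by
  simp [thetaPiVec]

theorem norm_thetaPiFnl (p : thetaPi θ) : ‖thetaPiFnl p‖ = 1 := by
  simp [thetaPiFnl]

theorem continuous_thetaPiVec : Continuous (thetaPiVec (θ := θ)) :=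
  continuous_subtype_val.comp (continuous_fst.comp continuous_subtype_val)

theorem continuous_thetaPiFnl : Continuous (thetaPiFnl (θ := θ)) :=
  continuous_subtype_val.comp (continuous_snd.comp continuous_subtype_val)

theorem dist_thetaPi_eq_max (p q : thetaPi θ) :
    dist p q = max ‖thetaPiVec p - thetaPiVec q‖ ‖thetaPiFnl p - thetaPiFnl q‖ := by
  rw [Subtype.dist_eq, Prod.dist_eq, Subtype.dist_eq, Subtype.dist_eq, dist_eq_norm, dist_eq_norm]
  rfl

theorem norm_sub_add_norm_sub_le_two_mul_dist (p q : thetaPi θ) :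
    ‖thetaPiVec p - thetaPiVec q‖ + ‖thetaPiFnl p - thetaPiFnl q‖ ≤ 2 * dist p q := by
  rw [dist_thetaPi_eq_max, two_mul]
  exact add_le_add (le_max_left _ _) (le_max_right _ _)

theorem completeSpace_thetaPi [CompleteSpace X] (hθ : Continuous θ) :
    CompleteSpace (thetaPi θ) := by
  have : CompleteSpace (Metric.sphere (0 : X) 1) := Metric.isClosed_sphere.completeSpace_coe
  have : CompleteSpace (Metric.sphere (0 : StrongDual ℝ Y) 1) :=
    Metric.isClosed_sphere.completeSpace_coe
  have : IsClosed (thetaPi θ) := isClosed_eq hθ continuous_const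
  exact this.completeSpace_coe

/-- The antipodal map `(x, y*) ↦ (-x, -y*)` of `Π_θ(X, Y)`, for an even function `θ`. -/
noncomputable def thetaPiNeg (hθ : ∀ p, θ (-p) = θ p) (p : thetaPi θ) : thetaPi θ :=
  ⟨-p.1, (hθ p.1).trans p.2⟩

variable (hθ : ∀ p, θ (-p) = θ p)

theorem thetaPiVec_thetaPiNeg (p : thetaPi θ) :
    thetaPiVec (thetaPiNeg hθ p) = -thetaPiVec p := rfl

theorem thetaPiFnl_thetaPiNeg (p : thetaPi θ) :
    thetaPiFnl (thetaPiNeg hθ p) = -thetaPiFnl p := rfl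

theorem involutive_thetaPiNeg : Function.Involutive (thetaPiNeg hθ) :=
  fun p => Subtype.ext (neg_neg p.1)

theorem isometry_thetaPiNeg : Isometry (thetaPiNeg hθ) := by
  refine Isometry.of_dist_eq fun p q => ?_
  simp only [dist_thetaPi_eq_max, thetaPiVec_thetaPiNeg, thetaPiFnl_thetaPiNeg, neg_sub_neg,
    norm_sub_rev]

theorem dist_thetaPiNeg_eq_max (p q : thetaPi θ) :
    dist p (thetaPiNeg hθ q) =
      max ‖thetaPiVec p + thetaPiVec q‖ ‖thetaPiFnl p + thetaPiFnl q‖ := by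
  rw [dist_thetaPi_eq_max, thetaPiVec_thetaPiNeg, thetaPiFnl_thetaPiNeg, sub_neg_eq_add,
    sub_neg_eq_add]

theorem min_norm_add_norm_le_two_mul_signDist (p q : thetaPi θ) :
    min (‖thetaPiVec p - thetaPiVec q‖ + ‖thetaPiFnl p - thetaPiFnl q‖)
      (‖thetaPiVec p + thetaPiVec q‖ + ‖thetaPiFnl p + thetaPiFnl q‖) ≤
      2 * signDist (thetaPiNeg hθ) p q := by
  rw [signDist, mul_min_of_nonneg _ _ zero_le_two]
  refine min_le_min (norm_sub_add_norm_sub_le_two_mul_dist p q) ?_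
  simpa only [thetaPiVec_thetaPiNeg, thetaPiFnl_thetaPiNeg, sub_neg_eq_add]
    using norm_sub_add_norm_sub_le_two_mul_dist p (thetaPiNeg hθ q)

theorem apply_ne_neg_one_of_dist_lt {r : ℝ}
    (hr : ∀ ⦃p q : SphereProd X Y⦄, dist p q < r → dist (θ p) (θ q) < 1) {p : SphereProd X Y}
    (q : thetaPi θ) (hpq : dist p q.1 < r) : θ p ≠ -1 := by
  intro hp
  have h := hr hpq
  rw [hp, show θ q.1 = 1 from q.2, Real.dist_eq] at h
  norm_num at h

theorem exists_forall_signDist_thetaPiNeg_lt (hθ_unif : UniformContinuous θ)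
    (hθ_odd : ∀ x f, θ (-x, f) = -θ (x, f)) {ε : ℝ} (hε : 0 < ε) :
    ∃ r > 0, ∀ p q : thetaPi θ,
      min ‖thetaPiVec p - thetaPiVec q‖ ‖thetaPiVec p + thetaPiVec q‖ < r →
      min ‖thetaPiFnl p - thetaPiFnl q‖ ‖thetaPiFnl p + thetaPiFnl q‖ < r →
      signDist (thetaPiNeg hθ) p q < ε := by
  obtain ⟨r, hr, hθr⟩ := Metric.uniformContinuous_iff.1 hθ_unif 1 one_pos
  refine ⟨min ε r, lt_min hε hr, fun p q hvec hfnl => ?_⟩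
  have hmixed : ¬ (‖thetaPiVec p + thetaPiVec q‖ < r ∧ ‖thetaPiFnl p - thetaPiFnl q‖ < r) := by
    rintro ⟨hv, hf⟩
    refine apply_ne_neg_one_of_dist_lt hθr (p := (-p.1.1, p.1.2)) q ?_ ?_
    · rw [Prod.dist_eq, Subtype.dist_eq, Subtype.dist_eq, dist_eq_norm, dist_eq_norm]
      refine max_lt ?_ hf
      rwa [coe_neg_sphere, ← neg_add', norm_neg]
    · rw [hθ_odd, show θ (p.1.1, p.1.2) = 1 from p.2]
  have hmixed' : ¬ (‖thetaPiVec p - thetaPiVec q‖ < r ∧ ‖thetaPiFnl p + thetaPiFnl q‖ < r) := by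
    rintro ⟨hv, hf⟩
    refine apply_ne_neg_one_of_dist_lt hθr (p := (p.1.1, -p.1.2)) q ?_ ?_
    · rw [Prod.dist_eq, Subtype.dist_eq, Subtype.dist_eq, dist_eq_norm, dist_eq_norm]
      refine max_lt hv ?_
      rwa [coe_neg_sphere, ← neg_add', norm_neg]
    · have hneg : θ (-p.1.1, -p.1.2) = 1 := (hθ p.1).trans p.2
      rwa [hθ_odd, neg_eq_iff_eq_neg] at hneg
  rw [signDist, dist_thetaPi_eq_max, dist_thetaPiNeg_eq_max]
  rcases min_lt_iff.1 hvec with hv | hv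
  · have hf := (min_lt_iff.1 hfnl).resolve_right fun hf =>
      hmixed' ⟨hv.trans_le (min_le_right _ _), hf.trans_le (min_le_right _ _)⟩
    exact min_lt_of_left_lt ((max_lt hv hf).trans_le (min_le_left _ _))
  · have hf := (min_lt_iff.1 hfnl).resolve_left fun hf =>
      hmixed ⟨hv.trans_le (min_le_right _ _), hf.trans_le (min_le_right _ _)⟩
    exact min_lt_of_right_lt ((max_lt hv hf).trans_le (min_le_left _ _))

theorem exists_rankOne_peak [UniformConvexSpace X] (hY : IsUniformlySmooth Y)
    (hθ_unif : UniformContinuous θ) (hθ_odd : ∀ x f, θ (-x, f) = -θ (x, f)) {ε : ℝ}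
    (hε : 0 < ε) :
    ∃ κ ∈ Set.Ioc (0 : ℝ) 1, ∀ p₀ : thetaPi θ, ∃ (g : StrongDual ℝ X) (y : Y),
      ‖g‖ = 1 ∧ ‖y‖ = 1 ∧ ∀ p : thetaPi θ, ε ≤ signDist (thetaPiNeg hθ) p p₀ →
        |g (thetaPiVec p) * thetaPiFnl p y| + κ ≤ g (thetaPiVec p₀) * thetaPiFnl p₀ y := by
  obtain ⟨r, hr, hnear⟩ := exists_forall_signDist_thetaPiNeg_lt hθ hθ_unif hθ_odd hε
  obtain ⟨δ₁, hδ₁, hslice₁⟩ := exists_forall_slice_min_norm_lt X hr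
  obtain ⟨δ₂, hδ₂, hslice₂⟩ := hY.exists_forall_dual_slice_min_norm_lt hr
  obtain ⟨δ, hδ, hδ1, hδδ₁, hδδ₂⟩ : ∃ δ : ℝ, 0 < δ ∧ δ ≤ 1 ∧ δ ≤ δ₁ ∧ δ ≤ δ₂ :=
    ⟨min 1 (min δ₁ δ₂), by positivity, by simp, by simp, by simp⟩
  refine ⟨δ / 2, ⟨half_pos hδ, by linarith⟩, fun p₀ => ?_⟩
  obtain ⟨g, hg, hgx₀⟩ := exists_dual_vector ℝ (thetaPiVec p₀) (by simp [norm_thetaPiVec])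
  replace hgx₀ : g (thetaPiVec p₀) = 1 := by simpa [norm_thetaPiVec] using hgx₀
  obtain ⟨y, hy, hfy⟩ := exists_norm_eq_one_lt_apply (thetaPiFnl p₀) (r := 1 - δ / 2)
    (by linarith) (by rw [norm_thetaPiFnl]; linarith)
  refine ⟨g, y, hg, hy, fun p hfar => ?_⟩
  suffices hle : |g (thetaPiVec p)| * |thetaPiFnl p y| ≤ 1 - δ by
    rw [abs_mul, hgx₀]
    linarith
  have hgx1 : |g (thetaPiVec p)| ≤ 1 := by
    simpa [hg, norm_thetaPiVec] using g.le_opNorm (thetaPiVec p)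
  have hfy1 : |thetaPiFnl p y| ≤ 1 := by
    simpa [hy, norm_thetaPiFnl] using (thetaPiFnl p).le_opNorm y
  by_contra! hlt
  have hgx : 1 - δ < |g (thetaPiVec p)| :=
    hlt.trans_le (mul_le_of_le_one_right (abs_nonneg _) hfy1)
  have hfy' : 1 - δ < |thetaPiFnl p y| :=
    hlt.trans_le (mul_le_of_le_one_left (abs_nonneg _) hgx1)
  exact hfar.not_gt (hnear p p₀
    (hslice₁ g hg.le _ _ (norm_thetaPiVec p).le (norm_thetaPiVec p₀).le (by linarith)
      (by linarith))
    (hslice₂ y hy _ _ (norm_thetaPiFnl p).le (norm_thetaPiFnl p₀).le (by linarith)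
      (by linarith)))

end ThetaPi

section ThetaRadius

variable {X Y W Z : Type*} [NormedAddCommGroup X] [NormedSpace ℝ X]
  [NormedAddCommGroup Y] [NormedSpace ℝ Y] [NormedAddCommGroup W] [NormedSpace ℝ W]
  [NormedAddCommGroup Z] [NormedSpace ℝ Z] {θ : SphereProd X Y → ℝ}

theorem thetaRadius_eq_norm (Φ : evenBCF θ W) : thetaRadius Φ = ‖Φ.1‖ :=
  Φ.1.norm_eq_iSup_norm.symm

theorem evenBCF_apply_thetaPiNeg (hθ : ∀ p, θ (-p) = θ p) (Φ : evenBCF θ W) (p : thetaPi θ) :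
    Φ.1 (thetaPiNeg hθ p) = Φ.1 p :=
  Φ.2 p _ (thetaPiVec_thetaPiNeg hθ p) (thetaPiFnl_thetaPiNeg hθ p)

theorem stronglyAttainsThetaRadius_of_slicesLocalize [CompleteSpace X] (hθ_cont : Continuous θ)
    (hθ : ∀ p, θ (-p) = θ p) (hne : (thetaPi θ).Nonempty) (Φ : evenBCF θ W)
    (hloc : ∀ ε > 0, SlicesLocalize (signDist (thetaPiNeg hθ)) (fun p => ‖Φ.1 p‖) ‖Φ.1‖ ε) :
    StronglyAttainsThetaRadius Φ := by
  have := completeSpace_thetaPi hθ_cont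
  have := hne.to_subtype
  obtain ⟨p₀, hp₀, hstrong⟩ := exists_strong_maximizer_of_slicesLocalize
    (isometry_thetaPiNeg hθ) (involutive_thetaPiNeg hθ) Φ.1.continuous.norm
    (fun p => by rw [evenBCF_apply_thetaPiNeg]) (isLUB_range_norm_apply Φ.1) hloc
  rw [StronglyAttainsThetaRadius, thetaRadius_eq_norm]
  refine ⟨p₀, hp₀, fun u hu => ?_⟩
  have hdist : Tendsto (fun n => 2 * signDist (thetaPiNeg hθ) (u n) p₀) atTop (𝓝 0) := by
    simpa using (hstrong u hu).const_mul 2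
  exact squeeze_zero (fun n => le_min (by positivity) (by positivity))
    (fun n => min_norm_add_norm_le_two_mul_signDist hθ (u n) p₀) hdist

theorem hasPeakPerturbations_evenBCF [UniformConvexSpace X] (hY : IsUniformlySmooth Y)
    [Nontrivial W] (hθ_unif : UniformContinuous θ) (hθ : ∀ p, θ (-p) = θ p)
    (hθ_odd : ∀ x f, θ (-x, f) = -θ (x, f)) (J : Z →ₗ[ℝ] evenBCF θ W)
    (hJ_rankOne : ∀ (g : StrongDual ℝ X) (y : Y) (w : W), ∃ Φ : Z,
      (∀ p : thetaPi θ, (J Φ).1 p = (g (thetaPiVec p) * thetaPiFnl p y) • w) ∧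
        ‖Φ‖ ≤ ‖g‖ * ‖y‖ * ‖w‖) :
    HasPeakPerturbations ((evenBCF θ W).subtype ∘ₗ J) (signDist (thetaPiNeg hθ)) := by
  refine hasPeakPerturbations_of_scalar_peaks fun ε hε => ?_
  obtain ⟨κ, hκ, hpeak⟩ := exists_rankOne_peak hθ hY hθ_unif hθ_odd hε
  refine ⟨κ, hκ, fun p₀ => ?_⟩
  obtain ⟨g, y, hg, hy, hgap⟩ := hpeak p₀
  refine ⟨fun p => g (thetaPiVec p) * thetaPiFnl p y, hgap, fun w => ?_⟩
  have hrankOne := hJ_rankOne g y w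
  rwa [hg, hy, one_mul, one_mul] at hrankOne

variable {J : Z →ₗ[ℝ] evenBCF θ W} {hθ : ∀ p, θ (-p) = θ p}

theorem isSigmaPorousSet_compl_stronglyAttainsThetaRadius [CompleteSpace X]
    (hθ_cont : Continuous θ) (hne : (thetaPi θ).Nonempty) (hJ_norm : ∀ Φ : Z, ‖J Φ‖ ≤ ‖Φ‖)
    (hpeak : HasPeakPerturbations ((evenBCF θ W).subtype ∘ₗ J) (signDist (thetaPiNeg hθ)))
    (Θ : evenBCF θ W) : IsSigmaPorousSet {Φ : Z | StronglyAttainsThetaRadius (Θ + J Φ)}ᶜ := by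
  have := hne.to_subtype
  refine isSigmaPorousSet_of_subset_iUnion (fun n : ℕ => hpeak.isPorousSet_not_slicesLocalize
    hJ_norm (Nat.one_div_pos_of_nat (n := n)) Θ.1) fun Φ hΦ => ?_
  by_contra hnot
  refine hΦ (stronglyAttainsThetaRadius_of_slicesLocalize hθ_cont hθ hne _ fun ε hε => ?_)
  obtain ⟨n, hn⟩ := exists_nat_one_div_lt hε
  rw [Set.mem_iUnion, not_exists] at hnot
  obtain ⟨p₀, γ, hγ, hball⟩ := not_not.1 (hnot n)
  exact ⟨p₀, γ, hγ, fun p hp => (hball p hp).trans hn⟩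

theorem exists_thetaRadius_attaining_near [CompleteSpace X] [CompleteSpace Z]
    (hθ_cont : Continuous θ) (hne : (thetaPi θ).Nonempty) (hJ_norm : ∀ Φ : Z, ‖J Φ‖ ≤ ‖Φ‖)
    (hpeak : HasPeakPerturbations ((evenBCF θ W).subtype ∘ₗ J) (signDist (thetaPiNeg hθ)))
    {ε : ℝ} (hε : 0 < ε) :
    ∃ η : ℝ, 0 < η ∧ ∀ (Φ : Z) (p : thetaPi θ), thetaRadius (J Φ) = 1 → 1 - η < ‖(J Φ).1 p‖ →
      ∃ (Ψ : Z) (q : thetaPi θ), thetaRadius (J Ψ) = 1 ∧ ‖(J Ψ).1 q‖ = 1 ∧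
        ‖thetaPiVec q - thetaPiVec p‖ + ‖thetaPiFnl q - thetaPiFnl p‖ < ε ∧
        thetaRadius (J Ψ - J Φ) < ε := by
  simp only [thetaRadius_eq_norm]
  have hdense : Dense {Φ : Z | ∃ q, ‖(J Φ).1 q‖ = ‖(J Φ).1‖} := by
    have hstrong := (isSigmaPorousSet_compl_stronglyAttainsThetaRadius hθ_cont hne hJ_norm hpeak
      0).dense_compl
    rw [compl_compl] at hstrong
    refine hstrong.mono ?_
    rintro Φ ⟨q, hq, -⟩
    rw [zero_add, thetaRadius_eq_norm] at hq
    exact ⟨q, hq⟩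
  obtain ⟨η, hη, hnear⟩ := hpeak.exists_unit_normAttaining_near hJ_norm hdense (half_pos hε)
  refine ⟨η, hη, fun Φ p hΦ hp => ?_⟩
  obtain ⟨Ψ, q, hΨ, hq, hqp, hΨΦ⟩ := hnear Φ p hΦ hp
  obtain ⟨q', hq', hq'p⟩ := exists_apply_eq_and_dist_eq_signDist (isometry_thetaPiNeg hθ)
    (involutive_thetaPiNeg hθ) (evenBCF_apply_thetaPiNeg hθ (J Ψ)) q p
  refine ⟨Ψ, q', hΨ, (congrArg norm hq').trans hq, ?_, hΨΦ.trans (half_lt_self hε)⟩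
  linarith [norm_sub_add_norm_sub_le_two_mul_dist q' p]

end ThetaRadius

section OperatorForm

variable {X Y : Type*} [NormedAddCommGroup X] [NormedSpace ℝ X]
  [NormedAddCommGroup Y] [NormedSpace ℝ Y] {θ : SphereProd X Y → ℝ}

theorem norm_thetaPiFnl_apply_le (T : X →L[ℝ] Y) (p : thetaPi θ) :
    ‖thetaPiFnl p (T (thetaPiVec p))‖ ≤ ‖T‖ := by
  simpa [norm_thetaPiFnl, norm_thetaPiVec] using (thetaPiFnl p).le_of_opNorm_le_of_le
    (norm_thetaPiFnl p).le (T.le_opNorm (thetaPiVec p))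

variable (θ) in
/-- The even function `(x, y*) ↦ y* (T x)` on `Π_θ(X, Y)` associated with a bounded operator `T`;
its `θ`-numerical radius is the numerical radius of `T` when `θ` is the duality pairing. -/
noncomputable def operatorForm : (X →L[ℝ] Y) →ₗ[ℝ] evenBCF θ ℝ where
  toFun T := ⟨BoundedContinuousFunction.ofNormedAddCommGroup
      (fun p => thetaPiFnl p (T (thetaPiVec p)))
      (continuous_thetaPiFnl.clm_apply (T.continuous.comp continuous_thetaPiVec)) ‖T‖
      (norm_thetaPiFnl_apply_le T),
    fun p q hv hf => by simp [hv, hf]⟩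
  map_add' S T := by ext p; simp
  map_smul' c T := by ext p; simp

theorem operatorForm_apply (T : X →L[ℝ] Y) (p : thetaPi θ) :
    (operatorForm θ T).1 p = thetaPiFnl p (T (thetaPiVec p)) := rfl

theorem norm_operatorForm_le (T : X →L[ℝ] Y) : ‖operatorForm θ T‖ ≤ ‖T‖ :=
  (BoundedContinuousFunction.norm_le (norm_nonneg T)).2 (norm_thetaPiFnl_apply_le T)

theorem exists_operatorForm_eq_rankOne (g : StrongDual ℝ X) (y : Y) (w : ℝ) :
    ∃ T : X →L[ℝ] Y,
      (∀ p : thetaPi θ, (operatorForm θ T).1 p = (g (thetaPiVec p) * thetaPiFnl p y) • w) ∧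
        ‖T‖ ≤ ‖g‖ * ‖y‖ * ‖w‖ := by
  refine ⟨w • g.smulRight y, fun p => ?_, ?_⟩
  · rw [operatorForm_apply, smul_apply, ContinuousLinearMap.smulRight_apply, map_smul, map_smul,
      smul_eq_mul, smul_eq_mul, smul_eq_mul, mul_comm]
  · rw [norm_smul, ContinuousLinearMap.norm_smulRight_apply, mul_comm]

end OperatorForm

section NumericalRadius

variable {X : Type*} [NormedAddCommGroup X] [NormedSpace ℝ X]

variable (X) in
/-- The duality pairing `(x, x*) ↦ x* x` on `S_X × S_{X*}`, for which the `θ`-numerical radius is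
the classical numerical radius. -/
def spherePairing (p : SphereProd X X) : ℝ := (p.2 : StrongDual ℝ X) (p.1 : X)

theorem lipschitzWith_spherePairing : LipschitzWith 2 (spherePairing X) := by
  refine LipschitzWith.of_dist_le_mul fun p q => ?_
  have hvec : ‖(p.2 : StrongDual ℝ X) (p.1 - q.1 : X)‖ ≤ dist p q :=
    ((p.2 : StrongDual ℝ X).le_opNorm _).trans (by
      rw [norm_eq_of_mem_sphere, one_mul, ← dist_eq_norm]
      exact le_max_left _ _)
  have hfnl : ‖((p.2 : StrongDual ℝ X) - q.2) (q.1 : X)‖ ≤ dist p q :=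
    (((p.2 : StrongDual ℝ X) - q.2).le_opNorm _).trans (by
      rw [norm_eq_of_mem_sphere, mul_one, ← dist_eq_norm]
      exact le_max_right _ _)
  have hsplit : spherePairing X p - spherePairing X q =
      (p.2 : StrongDual ℝ X) (p.1 - q.1 : X) + ((p.2 : StrongDual ℝ X) - q.2) (q.1 : X) := by
    simp [spherePairing]
  rw [dist_eq_norm, hsplit, NNReal.coe_ofNat, two_mul]
  exact norm_add_le_of_le hvec hfnl

theorem nonempty_thetaPi_spherePairing [Nontrivial X] :
    (thetaPi (spherePairing X)).Nonempty := by
  obtain ⟨x, hx⟩ := exists_norm_eq X zero_le_one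
  obtain ⟨f, hf, hfx⟩ := exists_dual_vector ℝ x (by simp [hx])
  refine ⟨(⟨x, by simpa using hx⟩, ⟨f, by simpa using hf⟩), ?_⟩
  change f x = 1
  simpa [hx] using hfx

theorem thetaRadius_operatorForm (T : X →L[ℝ] X) :
    thetaRadius (operatorForm (spherePairing X) T) = numericalRadius T := by
  unfold thetaRadius numericalRadius
  rw [iSup]
  congr 1
  ext s
  constructor
  · rintro ⟨p, rfl⟩
    exact ⟨thetaPiVec p, thetaPiFnl p, norm_thetaPiVec p, norm_thetaPiFnl p, p.2, rfl⟩
  · rintro ⟨x, f, hx, hf, hfx, rfl⟩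
    exact ⟨⟨(⟨x, by simpa using hx⟩, ⟨f, by simpa using hf⟩), hfx⟩, rfl⟩

theorem StronglyAttainsThetaRadius.attainsNumericalRadius {T : X →L[ℝ] X}
    (hT : StronglyAttainsThetaRadius (operatorForm (spherePairing X) T)) :
    AttainsNumericalRadius T := by
  obtain ⟨p, hp, -⟩ := hT
  rw [thetaRadius_operatorForm] at hp
  exact ⟨thetaPiVec p, thetaPiFnl p, norm_thetaPiVec p, norm_thetaPiFnl p, p.2, hp⟩

theorem isSigmaPorousSet_compl_attainsNumericalRadius [Nontrivial X] [CompleteSpace X]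
    [UniformConvexSpace X] (hX : IsUniformlySmooth X) :
    IsSigmaPorousSet {T : X →L[ℝ] X | AttainsNumericalRadius T}ᶜ := by
  have hpeak := hasPeakPerturbations_evenBCF hX lipschitzWith_spherePairing.uniformContinuous
    (θ := spherePairing X) (W := ℝ) (fun p => by simp [spherePairing])
    (fun x f => by simp [spherePairing])
    (operatorForm (spherePairing X)) exists_operatorForm_eq_rankOne
  have hporous := isSigmaPorousSet_compl_stronglyAttainsThetaRadius
    (J := operatorForm (spherePairing X)) lipschitzWith_spherePairing.continuous
    nonempty_thetaPi_spherePairing norm_operatorForm_le hpeak 0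
  simp only [zero_add] at hporous
  exact hporous.mono (Set.compl_subset_compl.2 fun T hT => hT.attainsNumericalRadius)

end NumericalRadius

theorem rankOne_of_finiteRank
    {X Y W Z : Type*} [NormedAddCommGroup X] [NormedSpace ℝ X]
    [NormedAddCommGroup Y] [NormedSpace ℝ Y] [NormedAddCommGroup W] [NormedSpace ℝ W]
    [NormedAddCommGroup Z] [NormedSpace ℝ Z] {θ : SphereProd X Y → ℝ}
    {J : Z →ₗ[ℝ] evenBCF θ W}
    (hJ_finiteRank : ∀ T : X →L[ℝ] Y, FiniteDimensional ℝ (LinearMap.range T.toLinearMap) →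
      ∀ w : W, ∃ Φ : Z, (∀ p : thetaPi θ, (J Φ).1 p = thetaPiFnl p (T (thetaPiVec p)) • w) ∧
        ‖Φ‖ ≤ ‖T‖ * ‖w‖)
    (g : StrongDual ℝ X) (y : Y) (w : W) :
    ∃ Φ : Z, (∀ p : thetaPi θ, (J Φ).1 p = (g (thetaPiVec p) * thetaPiFnl p y) • w) ∧
      ‖Φ‖ ≤ ‖g‖ * ‖y‖ * ‖w‖ := by
  have hrank : FiniteDimensional ℝ (LinearMap.range (g.smulRight y).toLinearMap) := by
    refine Submodule.finiteDimensional_of_le (S₂ := Submodule.span ℝ {y}) ?_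
    rintro _ ⟨x, rfl⟩
    exact Submodule.mem_span_singleton.2 ⟨g x, rfl⟩
  simpa only [ContinuousLinearMap.smulRight_apply, map_smul, smul_eq_mul,
    ContinuousLinearMap.norm_smulRight_apply] using hJ_finiteRank (g.smulRight y) hrank w

theorem corollary1p1_general
    {X Y W Z : Type*}
    [NormedAddCommGroup X] [NormedSpace ℝ X] [CompleteSpace X] [UniformConvexSpace X]
    [NormedAddCommGroup Y] [NormedSpace ℝ Y] (hY : IsUniformlySmooth Y)
    [NormedAddCommGroup W] [NormedSpace ℝ W] [Nontrivial W]
    (θ : SphereProd X Y → ℝ)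
    (hθ_unif : UniformContinuous θ)
    (hθ_odd₁ : ∀ x f, θ (-x, f) = -θ (x, f))
    (hθ_odd₂ : ∀ x f, θ (x, -f) = -θ (x, f))
    (hθ_ne : (thetaPi θ).Nonempty)
    [NormedAddCommGroup Z] [NormedSpace ℝ Z]
    (J : Z →ₗ[ℝ] evenBCF θ W)
    (hJ_norm : ∀ Φ : Z, ‖J Φ‖ ≤ ‖Φ‖)
    (hJ_rankOne : ∀ (g : StrongDual ℝ X) (y : Y) (w : W), ∃ Φ : Z,
      (∀ p : thetaPi θ, (J Φ).1 p = (g (thetaPiVec p) * thetaPiFnl p y) • w) ∧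
        ‖Φ‖ ≤ ‖g‖ * ‖y‖ * ‖w‖) :
    (∀ Θ : evenBCF θ W,
      IsSigmaPorousSet {Φ : Z | StronglyAttainsThetaRadius (Θ + J Φ)}ᶜ) ∧
    (CompleteSpace Z → ∀ ε : ℝ, 0 < ε → ∃ η : ℝ, 0 < η ∧
      ∀ (Φ : Z) (p : thetaPi θ), thetaRadius (J Φ) = 1 → 1 - η < ‖(J Φ).1 p‖ →
        ∃ (Ψ : Z) (q : thetaPi θ), thetaRadius (J Ψ) = 1 ∧ ‖(J Ψ).1 q‖ = 1 ∧
          ‖thetaPiVec q - thetaPiVec p‖ + ‖thetaPiFnl q - thetaPiFnl p‖ < ε ∧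
          thetaRadius (J Ψ - J Φ) < ε) ∧
    (IsUniformlySmooth X →
      IsSigmaPorousSet {T : X →L[ℝ] X | AttainsNumericalRadius T}ᶜ) := by
  have hθ_even : ∀ p, θ (-p) = θ p := fun p =>
    (hθ_odd₁ p.1 (-p.2)).trans (by rw [hθ_odd₂, neg_neg])
  have hpeak := hasPeakPerturbations_evenBCF hY hθ_unif hθ_even hθ_odd₁ J hJ_rankOne
  have hX : Nontrivial X := by
    obtain ⟨p⟩ := hθ_ne.to_subtype
    exact ⟨thetaPiVec p, 0, norm_ne_zero_iff.1 (by simp [norm_thetaPiVec])⟩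
  exact ⟨isSigmaPorousSet_compl_stronglyAttainsThetaRadius hθ_unif.continuous hθ_ne hJ_norm hpeak,
    fun _ _ => exists_thetaRadius_attaining_near hθ_unif.continuous hθ_ne hJ_norm hpeak,
    isSigmaPorousSet_compl_attainsNumericalRadius⟩

theorem corollary1p1
    {X Y W Z : Type*}
    [NormedAddCommGroup X] [NormedSpace ℝ X] [CompleteSpace X] [UniformConvexSpace X]
    [NormedAddCommGroup Y] [NormedSpace ℝ Y] [CompleteSpace Y] (hY : IsUniformlySmooth Y)
    [NormedAddCommGroup W] [NormedSpace ℝ W] [CompleteSpace W] [Nontrivial W]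
    (θ : SphereProd X Y → ℝ)
    (hθ_unif : UniformContinuous θ)
    (hθ_odd₁ : ∀ x f, θ (-x, f) = -θ (x, f))
    (hθ_odd₂ : ∀ x f, θ (x, -f) = -θ (x, f))
    (hθ_ne : (thetaPi θ).Nonempty)
    -- `Z` carries its own norm; `J` is the inclusion when `Z` is a subspace of `C_{b,e}`
    [NormedAddCommGroup Z] [NormedSpace ℝ Z] [CompleteSpace Z]
    (J : Z →ₗ[ℝ] evenBCF θ W)
    (hJ_norm : ∀ Φ : Z, ‖J Φ‖ ≤ ‖Φ‖)
    (hJ_finiteRank : ∀ T : X →L[ℝ] Y, FiniteDimensional ℝ (LinearMap.range T.toLinearMap) →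
      ∀ w : W, ∃ Φ : Z, (∀ p : thetaPi θ, (J Φ).1 p = thetaPiFnl p (T (thetaPiVec p)) • w) ∧
        ‖Φ‖ ≤ ‖T‖ * ‖w‖) :
    (∀ Θ : evenBCF θ W,
      IsSigmaPorousSet {Φ : Z | StronglyAttainsThetaRadius (Θ + J Φ)}ᶜ) ∧
    (∀ ε : ℝ, 0 < ε → ∃ η : ℝ, 0 < η ∧
      ∀ (Φ : Z) (p : thetaPi θ), thetaRadius (J Φ) = 1 → 1 - η < ‖(J Φ).1 p‖ →
        ∃ (Ψ : Z) (q : thetaPi θ), thetaRadius (J Ψ) = 1 ∧ ‖(J Ψ).1 q‖ = 1 ∧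
          ‖thetaPiVec q - thetaPiVec p‖ + ‖thetaPiFnl q - thetaPiFnl p‖ < ε ∧
          thetaRadius (J Ψ - J Φ) < ε) ∧
    (IsUniformlySmooth X →
      IsSigmaPorousSet {T : X →L[ℝ] X | AttainsNumericalRadius T}ᶜ) := by
  have hgeneral := corollary1p1_general hY θ hθ_unif hθ_odd₁ hθ_odd₂ hθ_ne J hJ_norm
    (rankOne_of_finiteRank hJ_finiteRank)
  exact ⟨hgeneral.1, hgeneral.2.1 inferInstance, hgeneral.2.2⟩
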